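/- The ``Choix de Bruxelles'' operation takes a positive integer $n$, written in decimal, to any number obtained by choosing a nonempty substring of its digits whose first digit is not $0$, reading it as a number $s$, and replacing it in place by the decimal expansion of $2s$ or, if $s$ is even, of $s/2$; one may also leave $n$ unchanged. Let $\tau(n)$ be the least number of steps in which $n$ can be reached from $1$ by repeatedly applying this operation ($\tau(n)=-1$ if $n$ cannot be reached from $1$). Let $E$ be the following set of $62$ numbers: $$E=\{1,\ 2,\ 4,\ 8,\ 13,\ 16,\ 23,\ 26,\ 31,\ 32,\ 34,\ 46,\ 52,\ 56,\ 62,\ 64,\ 102,\ 104,\ 106,\ 111,\ 112,\ 114,\ 118,\ 121,\ 122,\ 124,\ 128,\ 142,\ 144,\ 148,\ 211,\ 212,\ 214,\ 221,\ 222,\ 224,\ 228,\ 242,\ 244,\ 248,\ 412,\ 422,\ 424,\ 442,\ 444,\ 448,\ 512,\ 1012,\ 1022,\ 1024,\ 1116,\ 1216,\ 1416,\ 2216,\ 2416,\ 4416,\ 11112,\ 12112,\ 14112,\ 22112,\ 24112,\ 44112\}.$$ **Theorem.** Let $n$ be a positive integer whose decimal expansion does not end in $0$ or $5$. Then $n$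 can be reached from $1$, and: 1. if $n\notin E$ (in particular, if $n>44112$), then $\log_{10} n+5<\tau(n)$; 2. if $n\notin\{3,6\}$ (in particular, if $n\ge 10$), then $\tau(n)\le 12\log_{10} n$. -/

import Mathlib

namespace ChoixDeBruxelles

/-- One application of the operation "Choix de Bruxelles" takes `n` to `m`: either `m = n`, or the
decimal expansion of `n` is the concatenation of `A`, the decimal expansion of a number `s > 0`, and
`C`, and `m` is obtained by replacing `s` in situ by `2 * s` or, when `s` is even, by `s / 2`.
`Nat.digits 10` lists digits starting from the units, so `C` (the right end) is written first.
Since `Nat.digits 10 s` has a nonzero last entry, the substring starts with a nonzero digit. -/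
def Step (n m : ℕ) : Prop :=
  m = n ∨
    ∃ (A C : List ℕ) (s t : ℕ), 0 < s ∧
      Nat.digits 10 n = C ++ Nat.digits 10 s ++ A ∧
      (t = 2 * s ∨ (Even s ∧ t = s / 2)) ∧
      m = Nat.ofDigits 10 (C ++ Nat.digits 10 t ++ A)

/-- `ReachesIn k n m`: the number `m` can be reached from `n` in `k` steps. -/
def ReachesIn : ℕ → ℕ → ℕ → Prop
  | 0, n, m => m = n
  | k + 1, n, m => ∃ l, ReachesIn k n l ∧ Step l m

open Classical in
/-- The least number of steps in which `n` can be reached from `1`, or `-1` if `n` cannot be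
reached from `1`. -/
noncomputable def tau (n : ℕ) : ℤ :=
  if h : ∃ k, ReachesIn k 1 n then (Nat.find h : ℤ) else -1

/-- The finitely many small numbers, not ending in `0` or `5`, at which the lower bound fails. -/
def smallExceptions : Finset ℕ :=
  {1, 2, 4, 8, 13, 16, 23, 26, 31, 32, 34, 46,
   52, 56, 62, 64, 102, 104, 106, 111, 112, 114, 118, 121,
   122, 124, 128, 142, 144, 148, 211, 212, 214, 221, 222, 224,
   228, 242, 244, 248, 412, 422, 424, 442, 444, 448, 512, 1012,
   1022, 1024, 1116, 1216, 1416, 2216, 2416, 4416, 11112, 12112, 14112, 22112,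
   24112, 44112}

end ChoixDeBruxelles

/-!
Both bounds are elementary once the behaviour of the operation on very few numbers is known.

*Upper bound.* An operation on the leading digits of a number ignores the digits that follow
(`Step.append_digit`). Let `root n` be `5` if `5 ∣ n` and `1` otherwise. Every number below `100`
can be reached from its root in at most `12` steps, and, `3` and `6` excepted, in at most
`12 * log₁₀ n` steps. Now write a larger number as `10 * q + x` with `x < 10` and let `e = root q`.
From the root of `n` one reaches the number `10 * e + x`, which has the same root as `n` and is
below `100`, in at most `12` steps, and then replaces the leading `e` by `q`, which by induction
takes at most `12 * log₁₀ q` steps. As `n ≥ 10 * q`, this is `12 * log₁₀ n` steps at most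
(`exists_reachesIn_root`). The inequality `k ≤ 12 * log₁₀ n` is handled in the form
`10 ^ k ≤ n ^ 12`.

*Lower bound.* One step lengthens the decimal expansion by at most one digit, so the number of steps
minus the number of digits never decreases along a path. The numbers for which this difference can
be at most `4` form a finite set, the exceptional one. This is phrased by a `potential`,
equal to the number of steps from `1` on the exceptional set and to the number of digits plus `5`
elsewhere: it vanishes at `1` and grows by at most `1` in every step (`potential_le_of_step`), hence
is a lower bound for the number of steps. The growth condition has to be verified only at the
exceptional numbers, by listing everything they can be taken to (`successors`).
-/

namespace ChoixDeBruxelles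

/-! ### The operation, and its computable form -/

lemma Step.refl (n : ℕ) : Step n n := Or.inl rfl

lemma ReachesIn.trans {k l a b c : ℕ} (h₁ : ReachesIn k a b) (h₂ : ReachesIn l b c) :
    ReachesIn (k + l) a c := by
  induction l generalizing c with
  | zero => obtain rfl : c = b := h₂; exact h₁
  | succ l ih =>
    obtain ⟨d, hd, hs⟩ := h₂
    exact ⟨d, ih hd, hs⟩

/-- All numbers obtained from `n` by one operation, as a list: the substring to be replaced starts
at position `i` (counted from the units) and has length `j`. The test `Nat.digits 10 s = B` says
that `B` has a nonzero leading digit. -/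
def successors (n : ℕ) : List ℕ :=
  let D := Nat.digits 10 n
  n :: (List.range (D.length + 1)).flatMap fun i => (List.range (D.length + 1)).flatMap fun j =>
    let C := D.take i
    let B := (D.drop i).take j
    let A := (D.drop i).drop j
    let s := Nat.ofDigits 10 B
    if 0 < s ∧ Nat.digits 10 s = B then
      Nat.ofDigits 10 (C ++ Nat.digits 10 (2 * s) ++ A) ::
        if Even s then [Nat.ofDigits 10 (C ++ Nat.digits 10 (s / 2) ++ A)] else []
    else []

lemma mem_successors {n m : ℕ} : m ∈ successors n ↔ Step n m := by
  simp only [successors, List.mem_cons, List.mem_flatMap, List.mem_range]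
  constructor
  · rintro (h | ⟨i, -, j, -, h⟩)
    · exact Or.inl h
    · by_cases hs : 0 < Nat.ofDigits 10 (((Nat.digits 10 n).drop i).take j) ∧
          Nat.digits 10 (Nat.ofDigits 10 (((Nat.digits 10 n).drop i).take j)) =
            ((Nat.digits 10 n).drop i).take j
      · have hD : Nat.digits 10 n = (Nat.digits 10 n).take i ++
            Nat.digits 10 (Nat.ofDigits 10 (((Nat.digits 10 n).drop i).take j)) ++
            ((Nat.digits 10 n).drop i).drop j := by
          rw [hs.2, List.append_assoc, List.take_append_drop, List.take_append_drop]
        rw [if_pos hs, List.mem_cons] at h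
        rcases h with h | h
        · exact Or.inr ⟨_, _, _, _, hs.1, hD, Or.inl rfl, h⟩
        · split_ifs at h with he
          · exact Or.inr ⟨_, _, _, _, hs.1, hD, Or.inr ⟨he, rfl⟩, List.mem_singleton.mp h⟩
          · simp at h
      · simp [if_neg hs] at h
  · rintro (h | ⟨A, C, s, t, hs, hn, ht, rfl⟩)
    · exact Or.inl h
    · have hlen := congrArg List.length hn
      simp only [List.length_append] at hlen
      refine Or.inr ⟨C.length, by omega, (Nat.digits 10 s).length, by omega, ?_⟩
      rw [List.append_assoc] at hn
      have h₁ : (Nat.digits 10 n).take C.length = C := by rw [hn, List.take_left]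
      have h₂ : (Nat.digits 10 n).drop C.length = Nat.digits 10 s ++ A := by
        rw [hn, List.drop_left]
      rw [h₁, h₂, List.take_left, List.drop_left, Nat.ofDigits_digits, if_pos ⟨hs, rfl⟩]
      rcases ht with rfl | ⟨he, rfl⟩
      · exact List.mem_cons_self
      · rw [if_pos he]
        exact List.mem_cons_of_mem _ List.mem_cons_self

/-! ### The upper bound -/

lemma Step.append_digit {a b x : ℕ} (h : Step a b) (hx : x < 10) :
    Step (10 * a + x) (10 * b + x) := by
  rcases h with rfl | ⟨A, C, s, t, hs, ha, ht, rfl⟩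
  · exact Step.refl _
  · refine Or.inr ⟨A, x :: C, s, t, hs, ?_, ht, ?_⟩
    · have ha0 : a ≠ 0 := by
        rintro rfl
        have hs' : Nat.digits 10 s ≠ [] := Nat.digits_ne_nil_iff_ne_zero.mpr hs.ne'
        simp_all
      rw [add_comm, Nat.digits_add 10 (by norm_num) x a hx (Or.inr ha0), ha]
      simp
    · rw [List.cons_append, List.cons_append, Nat.ofDigits_cons]
      simp [add_comm]

lemma ReachesIn.append_digit {k a b x : ℕ} (h : ReachesIn k a b) (hx : x < 10) :
    ReachesIn k (10 * a + x) (10 * b + x) := by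
  induction k generalizing b with
  | zero => obtain rfl : b = a := h; rfl
  | succ k ih =>
    obtain ⟨c, hc, hs⟩ := h
    exact ⟨_, ih hc, hs.append_digit hx⟩

/-- The one-digit number from which `n` is to be reached. Reachability preserves divisibility by `5`
(in both directions), so that one starting point would not do. -/
def root (n : ℕ) : ℕ := if n % 5 = 0 then 5 else 1

/-- Numbers reachable from `1` (for `e = 1`) or from `5` (otherwise), sorted by the number of steps.
Together the two lists contain every positive number below `100`; the larger entries are only passed
on the way. -/
def layers (e : ℕ) : List (List ℕ) :=
  if e = 1 then
    [[1], [2], [4], [8], [16], [13, 26, 32, 112],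
     [23, 31, 34, 46, 52, 56, 62, 64, 114, 122, 124],
     [17, 28, 38, 43, 51, 53, 54, 57, 61, 68, 86, 92, 118, 142, 148],
     [14, 18, 19, 24, 27, 48, 58, 59, 71, 72, 74, 76, 78, 83, 91, 94, 172, 316],
     [7, 9, 12, 22, 29, 36, 37, 39, 44, 47, 73, 88, 96, 98, 158, 344],
     [6, 11, 21, 33, 42, 49, 66, 67, 69, 79, 84, 87, 93, 154, 388],
     [3, 41, 63, 77, 82, 89, 194, 198], [81, 97, 99]]
  else
    [[5], [10], [20], [40], [80], [160], [130, 260, 320], [65, 340, 460, 520],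
     [35, 125, 170, 510, 920], [55, 70, 85, 145, 910], [45, 75, 95, 110], [15, 25, 90, 120],
     [30, 50, 60]]

lemma reachesIn_of_mem_layer {e : ℕ} {L : List (List ℕ)} (h₀ : ∀ m ∈ L.getD 0 [], m = e)
    (h : ∀ i < L.length, ∀ m ∈ L.getD (i + 1) [], ∃ p ∈ L.getD i [], m ∈ successors p)
    {k m : ℕ} (hm : m ∈ L.getD k []) : ReachesIn k e m := by
  induction k generalizing m with
  | zero => exact h₀ m hm
  | succ k ih =>
    have hk : k < L.length := by
      by_contra hk
      simp [List.getElem?_eq_none (show L.length ≤ k + 1 by omega)] at hm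
    obtain ⟨p, hp, hpm⟩ := h k hk m hm
    exact ⟨p, ih hp, mem_successors.mp hpm⟩

lemma layers_valid : ∀ e ∈ [1, 5], (∀ m ∈ (layers e).getD 0 [], m = e) ∧
    ∀ i < (layers e).length, ∀ m ∈ (layers e).getD (i + 1) [],
      ∃ p ∈ (layers e).getD i [], m ∈ successors p := by
  decide +kernel

lemma exists_mem_layer : ∀ n < 100, n ≠ 0 → ∃ k < 13, n ∈ (layers (root n)).getD k [] ∧
    (n ≠ 3 ∧ n ≠ 6 → 10 ^ k ≤ n ^ 12) := by
  decide +kernel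

lemma root_congr {a b : ℕ} (h : a % 5 = b % 5) : root a = root b := by
  simp only [root, h]

lemma root_mem (n : ℕ) : root n ∈ [1, 5] := by
  unfold root
  split_ifs <;> simp

lemma exists_reachesIn_root_of_lt {n : ℕ} (hn : n < 100) (h0 : n ≠ 0) :
    ∃ k ≤ 12, ReachesIn k (root n) n ∧ (n ≠ 3 ∧ n ≠ 6 → 10 ^ k ≤ n ^ 12) := by
  obtain ⟨k, hk, hm, hb⟩ := exists_mem_layer n hn h0
  obtain ⟨h₀, h₁⟩ := layers_valid _ (root_mem n)
  exact ⟨k, by omega, reachesIn_of_mem_layer h₀ h₁ hm, hb⟩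

/-- Every positive number other than `3` and `6` is reached from its root in `k ≤ 12 * log₁₀ n`
steps. -/
lemma exists_reachesIn_root (n : ℕ) (h0 : n ≠ 0) (h3 : n ≠ 3) (h6 : n ≠ 6) :
    ∃ k, ReachesIn k (root n) n ∧ 10 ^ k ≤ n ^ 12 := by
  induction n using Nat.strong_induction_on with
  | _ n ih =>
    by_cases hn : n < 100
    · obtain ⟨k, -, hk, hb⟩ := exists_reachesIn_root_of_lt hn h0
      exact ⟨k, hk, hb ⟨h3, h6⟩⟩
    · obtain ⟨k, hk, hb⟩ := ih (n / 10) (by omega) (by omega) (by omega) (by omega)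
      have hx : n % 10 < 10 := Nat.mod_lt _ (by norm_num)
      have he : root (n / 10) = 1 ∨ root (n / 10) = 5 := by simpa using root_mem (n / 10)
      obtain ⟨l, hl, hr, -⟩ := exists_reachesIn_root_of_lt
        (n := 10 * root (n / 10) + n % 10) (by omega) (by omega)
      have hroot : root (10 * root (n / 10) + n % 10) = root n := root_congr (by omega)
      have hk' := hk.append_digit hx
      rw [Nat.div_add_mod] at hk'
      refine ⟨l + k, (hroot ▸ hr).trans hk', ?_⟩
      calc 10 ^ (l + k) ≤ 10 ^ 12 * (n / 10) ^ 12 := by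
            rw [pow_add]
            exact Nat.mul_le_mul (Nat.pow_le_pow_right (by norm_num) hl) hb
        _ = (10 * (n / 10)) ^ 12 := (mul_pow _ _ _).symm
        _ ≤ n ^ 12 := Nat.pow_le_pow_left (Nat.mul_div_le n 10) 12

/-! ### The lower bound -/

/-- The exceptional numbers, sorted by the number of steps in which they are reached from `1`. -/
def exceptionLayers : List (List ℕ) :=
  [[1], [2], [4], [8], [16], [13, 26, 32, 112],
   [23, 31, 34, 46, 52, 56, 62, 64, 111, 114, 122, 124, 212, 222, 224],
   [102, 104, 106, 118, 121, 128, 142, 144, 148, 211, 214, 221, 228, 242, 244, 248, 412, 422, 424,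
    442, 444, 448, 512],
   [1012, 1022, 1024, 1116, 1216, 1416, 2216, 2416, 4416],
   [11112, 12112, 14112, 22112, 24112, 44112]]

/-- A lower bound for the number of steps from `1` to `n`: the exact number of steps if `n` is
exceptional, and the number of digits plus `5` otherwise. -/
def potential (n : ℕ) : ℕ :=
  if n ∈ exceptionLayers.flatten then exceptionLayers.findIdx (fun l => n ∈ l)
  else (Nat.digits 10 n).length + 5

lemma exceptionLayers_valid : ∀ n ∈ exceptionLayers.flatten, n ∈ smallExceptions ∧
    potential n ≤ (Nat.digits 10 n).length + 5 ∧
    ∀ m ∈ successors n, potential m ≤ potential n + 1 := by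
  decide +kernel

lemma potential_le_length (n : ℕ) : potential n ≤ (Nat.digits 10 n).length + 5 := by
  by_cases hn : n ∈ exceptionLayers.flatten
  · exact (exceptionLayers_valid n hn).2.1
  · rw [potential, if_neg hn]

lemma potential_of_notMem {n : ℕ} (hn : n ∉ smallExceptions) :
    potential n = (Nat.digits 10 n).length + 5 :=
  if_neg fun h => hn (exceptionLayers_valid n h).1

lemma digits_length_le_of_le_mul {s t : ℕ} (h : t ≤ 2 * s) :
    (Nat.digits 10 t).length ≤ (Nat.digits 10 s).length + 1 := by
  rw [Nat.digits_length_le_iff (by norm_num), pow_succ]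
  have := Nat.lt_base_pow_length_digits (b := 10) (m := s) (by norm_num)
  omega

lemma Step.digits_length_le {n m : ℕ} (h : Step n m) :
    (Nat.digits 10 m).length ≤ (Nat.digits 10 n).length + 1 := by
  rcases h with rfl | ⟨A, C, s, t, -, hn, ht, rfl⟩
  · exact Nat.le_succ _
  · have hts : t ≤ 2 * s := by rcases ht with rfl | ⟨-, rfl⟩ <;> omega
    have hlen : (Nat.digits 10 (Nat.ofDigits 10 (C ++ Nat.digits 10 t ++ A))).length ≤
        (C ++ Nat.digits 10 t ++ A).length := by
      rw [Nat.digits_length_le_iff (by norm_num)]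
      apply Nat.ofDigits_lt_base_pow_length (by norm_num)
      intro x hx
      simp only [List.mem_append] at hx
      rcases hx with (hx | hx) | hx
      · exact Nat.digits_lt_base (m := n) (by norm_num) (by simp [hn, hx])
      · exact Nat.digits_lt_base (by norm_num) hx
      · exact Nat.digits_lt_base (m := n) (by norm_num) (by simp [hn, hx])
    have := digits_length_le_of_le_mul hts
    rw [hn]
    simp only [List.length_append] at hlen ⊢
    omega

lemma potential_le_of_step {n m : ℕ} (h : Step n m) : potential m ≤ potential n + 1 := by
  by_cases hn : n ∈ exceptionLayers.flatten
  · exact (exceptionLayers_valid n hn).2.2 m (mem_successors.mpr h)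
  · have h₁ := potential_le_length m
    have h₂ := h.digits_length_le
    rw [potential.eq_def n, if_neg hn]
    omega

lemma ReachesIn.potential_le {k n : ℕ} (h : ReachesIn k 1 n) : potential n ≤ k := by
  induction k generalizing n with
  | zero =>
    obtain rfl : n = 1 := h
    decide
  | succ k ih =>
    obtain ⟨l, hl, hs⟩ := h
    exact (potential_le_of_step hs).trans (Nat.succ_le_succ (ih hl))

/-! ### The number of steps -/

lemma exists_tau_eq {n : ℕ} (h : ∃ k, ReachesIn k 1 n) :
    ∃ k : ℕ, tau n = k ∧ ReachesIn k 1 n ∧ ∀ l, ReachesIn l 1 n → k ≤ l := by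
  classical
  refine ⟨Nat.find h, ?_, Nat.find_spec h, fun l hl => Nat.find_min' h hl⟩
  rw [tau, dif_pos h]

end ChoixDeBruxelles

open ChoixDeBruxelles in
theorem mainTheorem7 (n : ℕ) (h0 : n % 10 ≠ 0) (h5 : n % 10 ≠ 5) :
    (∃ k, ChoixDeBruxelles.ReachesIn k 1 n) ∧
    (n ∉ ChoixDeBruxelles.smallExceptions →
      Real.logb 10 (n : ℝ) + 5 < (ChoixDeBruxelles.tau n : ℝ)) ∧
    (n ≠ 3 ∧ n ≠ 6 →
      (ChoixDeBruxelles.tau n : ℝ) ≤ 12 * Real.logb 10 (n : ℝ)) := by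
  have hpos : 0 < n := by omega
  have hroot : root n = 1 := if_neg (by omega)
  have hex : ∃ k, ReachesIn k 1 n := by
    by_cases hn : n < 100
    · obtain ⟨k, -, hk, -⟩ := exists_reachesIn_root_of_lt hn hpos.ne'
      exact ⟨k, hroot ▸ hk⟩
    · obtain ⟨k, hk, -⟩ := exists_reachesIn_root n hpos.ne' (by omega) (by omega)
      exact ⟨k, hroot ▸ hk⟩
  obtain ⟨k, htau, hk, hmin⟩ := exists_tau_eq hex
  have hposR : (0 : ℝ) < n := by exact_mod_cast hpos
  refine ⟨hex, fun hn => ?_, fun hn => ?_⟩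
  · have hle := hk.potential_le
    rw [potential_of_notMem hn] at hle
    have hlog : Real.logb 10 n < ((Nat.digits 10 n).length : ℝ) := by
      rw [Real.logb_lt_iff_lt_rpow (by norm_num) hposR, Real.rpow_natCast]
      exact_mod_cast Nat.lt_base_pow_length_digits (by norm_num)
    have hleR : ((Nat.digits 10 n).length : ℝ) + 5 ≤ k := by exact_mod_cast hle
    rw [htau]
    push_cast
    linarith
  · obtain ⟨l, hl, hb⟩ := exists_reachesIn_root n hpos.ne' hn.1 hn.2
    have hkl : (k : ℝ) ≤ l := by exact_mod_cast hmin l (hroot ▸ hl)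
    have hlog : (l : ℝ) ≤ 12 * Real.logb 10 n := by
      have hb' : (10 : ℝ) ^ (l : ℝ) ≤ (n : ℝ) ^ 12 := by
        rw [Real.rpow_natCast]
        exact_mod_cast hb
      rw [← Real.le_logb_iff_rpow_le (by norm_num) (by positivity), Real.logb_pow] at hb'
      exact_mod_cast hb'
    rw [htau]
    push_cast
    linarith
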